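/- Let $n,p,s$ be integers with $p\ge 3$, $1\le s<p$ and $s\le n/\log p$. Let $X\in\mathbb R^{n\times p}$ be a fixed design with rows $x_1,\dots,x_n$, let $\beta^*\in\mathbb R^p$ have support $S^*=\{j:\beta^*_j\ne 0\}$ with $|S^*|=s$, and let $y=X\beta^*+e$, where $e_1,\dots,e_n$ are i.i.d. zero-mean sub-Gaussian random variables with parameter $\sigma>0$, i.e. $\mathbb E\,e^{\lambda e_i}\le e^{\sigma^2\lambda^2/2}$ for all $\lambda\in\mathbb R$. Write $\mathcal D=(X,y)$. Assume that there are positive constants $b_x,b_y,M,\kappa_-,\kappa_+$ such that $|X_{ij}|\le b_x$ for all $i,j$; $|y_i|\le b_y$ for all $i$ (almost surely); $\|\beta^*\|_2\le M$; and, for every $S\subseteq[p]$ with $|S|=s$, $$\kappa_-\le\lambda_{\min}(X_S^\top X_S/n)\le\lambda_{\max}(X_S^\top X_S/n)\le\kappa_+ .$$ *Objective and mistakes method.* For $S\subseteq[p]$ with $|S|=s$ let $$\mathcal R(S,\mathcal D)=\min\Big\{\textstyle\sum_{i=1}^n\big(y_i-(x_i)_S^\top\beta\big)^2:\ \beta\in\mathbb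 R^{S},\ \|\beta\|_2^2\le r^2\Big\}.$$ Let $\tilde S_0(\mathcal D)$ be a minimizer of $\mathcal R(\cdot,\mathcal D)$ over all $S$ with $|S|=s$ (ties broken arbitrarily), and for $0\le k\le s$ let $P_k(\mathcal D)=\{S:|S|=s,\ |S\setminus\tilde S_0(\mathcal D)|=k\}$ and $\tilde{\mathcal R}_k(\mathcal D)=\min_{S\in P_k(\mathcal D)}\mathcal R(S,\mathcal D)$. Given $\mathcal D$, the mistakes method $\tilde{\mathcal M}$ with parameters $\epsilon>0$ and $\Delta$ outputs each $S\in P_k(\mathcal D)$ with probability $$\frac{\exp\big(-\epsilon\tilde{\mathcal R}_k(\mathcal D)/(2\Delta)\big)}{\sum_{i=0}^s|P_i(\mathcal D)|\exp\big(-\epsilon\tilde{\mathcal R}_i(\mathcal D)/(2\Delta)\big)},$$ where the terms of the sum with $P_i(\mathcal D)=\emptyset$ are $0$. *Identifiability margin.* Let $\hat\Sigma=X^\top X/n$, for $|S|=s$ let $\hat D(S)=\hat\Sigma_{S^*\setminus S,S^*\setminus S}-\hat\Sigma_{S^*\setminus S,S}\hat\Sigma_{S,S}^{-1}\hat\Sigma_{S,S^*\setminus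 S}$, and $$\tau=\min_{S:\,|S|=s,\ 1\le|S\setminus S^*|\le s}\frac{\beta_{S^*\setminus S}^{*\top}\hat D(S)\beta^*_{S^*\setminus S}}{|S^*\setminus S|}.$$ *Claim.* There is a universal constant $C>0$ (independent of all the quantities above) such that, whenever the above assumptions hold, $r\ge\frac{\kappa_+}{\kappa_-}M+4\frac{\sigma b_x}{\kappa_-}$, $\Delta=2b_y^2+2b_x^2r^2s$ and $$\tau\ge\max\Big\{C\sigma^2 s,\ \frac{16\Delta}{\epsilon}\Big\}\frac{\log p}{n},$$ the probability, over the noise and the randomness of the method, that it returns the true support satisfies $$\mathbb P\big(\tilde{\mathcal M}(\mathcal D)=S^*\big)\ \ge\ \frac{1-18sp^{-2}}{1+2p^{-2}} .$$ -/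

import Mathlib

open MeasureTheory ProbabilityTheory

namespace PrivateBSS

noncomputable section

/-- A dataset of `n` observations `(x_i, y_i)` with `x_i ∈ ℝ^p` and `y_i ∈ ℝ`. -/
abbrev Dataset (n p : ℕ) : Type := Fin n → (Fin p → ℝ) × ℝ

/-- The outcome set: all supports `S ⊆ [p]` with `|S| = s`. -/
abbrev Outcome (p s : ℕ) : Type := {S : Finset (Fin p) // S.card = s}

/-- The best-subset-selection objective
`R(S, D) = min { ∑ i, (y_i - (x_i)_Sᵀ β)^2 : β ∈ ℝ^S, ‖β‖₂² ≤ r² }`. -/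
def objective {n p : ℕ} (r : ℝ) (S : Finset (Fin p)) (D : Dataset n p) : ℝ :=
  sInf ((fun β : S → ℝ => ∑ i, ((D i).2 - ∑ j : S, (D i).1 j * β j) ^ 2) ''
    {β : S → ℝ | ∑ j, β j ^ 2 ≤ r ^ 2})

/-- `best` selects, for every dataset, a support minimizing the objective (ties are broken
arbitrarily). -/
def IsBestSupport {n p s : ℕ} (r : ℝ) (best : Dataset n p → Outcome p s) : Prop :=
  ∀ (D : Dataset n p) (S : Outcome p s), objective r (best D).1 D ≤ objective r S.1 D

/-- The supports of size `s` making exactly `k` mistakes with respect to `S₀`. -/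
def mistakeClass {p s : ℕ} (S₀ : Outcome p s) (k : ℕ) : Finset (Outcome p s) :=
  Finset.univ.filter fun S => (S.1 \ S₀.1).card = k

/-- The smallest objective value in the `k`-th mistake class of `S₀`. -/
def classObjective {n p s : ℕ} (r : ℝ) (S₀ : Outcome p s) (k : ℕ) (D : Dataset n p) : ℝ :=
  sInf ((fun S : Outcome p s => objective r S.1 D) '' (mistakeClass S₀ k : Set (Outcome p s)))

/-- The weight `exp (-ε R(S̃_k(D), D) / (2Δ))` shared by all supports of the `k`-th class. -/
def classWeight {n p s : ℕ} (ε Δ r : ℝ) (S₀ : Outcome p s) (k : ℕ) (D : Dataset n p) : ℝ :=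
  Real.exp (-ε * classObjective r S₀ k D / (2 * Δ))

/-- The probability that the mistakes method built around `S₀` assigns to `S`. -/
def mistakesProb {n p s : ℕ} (ε Δ r : ℝ) (S₀ : Outcome p s) (D : Dataset n p)
    (S : Outcome p s) : ℝ :=
  classWeight ε Δ r S₀ (S.1 \ S₀.1).card D /
    ∑ i ∈ Finset.range (s + 1), ((mistakeClass S₀ i).card : ℝ) * classWeight ε Δ r S₀ i D

lemma mistakesProb_nonneg {n p s : ℕ} (ε Δ r : ℝ) (S₀ : Outcome p s) (D : Dataset n p)
    (S : Outcome p s) : 0 ≤ mistakesProb ε Δ r S₀ D S := by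
  unfold mistakesProb classWeight
  positivity

lemma sum_classWeight {n p s : ℕ} (ε Δ r : ℝ) (S₀ : Outcome p s) (D : Dataset n p) :
    ∑ S : Outcome p s, classWeight ε Δ r S₀ (S.1 \ S₀.1).card D =
      ∑ i ∈ Finset.range (s + 1), ((mistakeClass S₀ i).card : ℝ) * classWeight ε Δ r S₀ i D := by
  have hmaps : ∀ S ∈ (Finset.univ : Finset (Outcome p s)),
      (S.1 \ S₀.1).card ∈ Finset.range (s + 1) := by
    intro S _
    have h1 : (S.1 \ S₀.1).card ≤ S.1.card := Finset.card_le_card Finset.sdiff_subset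
    have h2 := S.2
    simp only [Finset.mem_range]
    omega
  rw [← Finset.sum_fiberwise_of_maps_to hmaps]
  refine Finset.sum_congr rfl fun i _ => ?_
  rw [← nsmul_eq_mul, ← Finset.sum_const]
  refine Finset.sum_congr rfl fun S hS => ?_
  rw [(Finset.mem_filter.mp hS).2]

lemma sum_mistakesProb {n p s : ℕ} (ε Δ r : ℝ) (S₀ : Outcome p s) (D : Dataset n p) :
    ∑ S : Outcome p s, mistakesProb ε Δ r S₀ D S = 1 := by
  unfold mistakesProb
  rw [← Finset.sum_div, sum_classWeight]
  refine div_self (ne_of_gt ?_)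
  rw [← sum_classWeight]
  exact Finset.sum_pos (fun S _ => Real.exp_pos _) ⟨S₀, Finset.mem_univ _⟩

/-- The mistakes method: the law of its output on the dataset `D`, where `best` selects the
optimal support around which the mistake classes are formed. -/
def mistakesMethod {n p s : ℕ} (ε Δ r : ℝ) (best : Dataset n p → Outcome p s)
    (D : Dataset n p) : PMF (Outcome p s) :=
  PMF.ofFintype (fun S => ENNReal.ofReal (mistakesProb ε Δ r (best D) D S)) (by
    rw [← ENNReal.ofReal_sum_of_nonneg fun S _ => mistakesProb_nonneg ε Δ r (best D) D S,
      sum_mistakesProb, ENNReal.ofReal_one])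

/-- `out` is the output of the randomized algorithm `A` on the random dataset `D`: the
conditional law of `out` given `D` is `A D`. -/
def IsOutputOf {Ω 𝒟 O : Type*} [MeasurableSpace Ω] [MeasurableSpace 𝒟] (μ : Measure Ω)
    (A : 𝒟 → PMF O) (D : Ω → 𝒟) (out : Ω → O) : Prop :=
  ∀ o : O, MeasurableSet {ω | out ω = o} ∧
    ∀ B : Set 𝒟, MeasurableSet B →
      μ {ω | D ω ∈ B ∧ out ω = o} = ∫⁻ ω in D ⁻¹' B, A (D ω) o ∂μ

/-- The dataset generated by the linear model `y = X β + e`. -/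
def linearModel {n p : ℕ} (X : Matrix (Fin n) (Fin p) ℝ) (β : EuclideanSpace ℝ (Fin p))
    (e : Fin n → ℝ) : Dataset n p :=
  fun i => (X i, ∑ j, X i j * β j + e i)

/-- The support of a coefficient vector. -/
def support {p : ℕ} (β : EuclideanSpace ℝ (Fin p)) : Finset (Fin p) :=
  Finset.univ.filter fun j => β j ≠ 0

/-- The block, with rows in `S` and columns in `T`, of the sample covariance `n⁻¹ Xᵀ X`; in
particular `covBlock X S S = X_Sᵀ X_S / n`. -/
def covBlock {n p : ℕ} (X : Matrix (Fin n) (Fin p) ℝ) (S T : Finset (Fin p)) : Matrix S T ℝ :=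
  ((n : ℝ)⁻¹ • (X.transpose * X)).submatrix (fun j : S => j.1) (fun j : T => j.1)

/-- Sparse Riesz condition: all eigenvalues of `X_Sᵀ X_S / n` lie in `[κm, κp]`, for every `S`
with `|S| = s`. -/
def SparseRiesz {n p : ℕ} (X : Matrix (Fin n) (Fin p) ℝ) (s : ℕ) (κm κp : ℝ) : Prop :=
  ∀ S : Finset (Fin p), S.card = s →
    ∀ l ∈ spectrum ℝ (covBlock X S S), κm ≤ l ∧ l ≤ κp

/-- The residual covariance
`D̂(S) = Σ̂_{T,T} - Σ̂_{T,S} Σ̂_{S,S}⁻¹ Σ̂_{S,T}` with `T = S* \ S`. -/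
def residualCov {n p : ℕ} (X : Matrix (Fin n) (Fin p) ℝ) (Sstar S : Finset (Fin p)) :
    Matrix ↥(Sstar \ S) ↥(Sstar \ S) ℝ :=
  covBlock X (Sstar \ S) (Sstar \ S) -
    covBlock X (Sstar \ S) S * (covBlock X S S)⁻¹ * covBlock X S (Sstar \ S)

/-- The discrimination margin `β_Tᵀ D̂(S) β_T` with `T = S* \ S`. -/
def margin {n p : ℕ} (X : Matrix (Fin n) (Fin p) ℝ) (β : EuclideanSpace ℝ (Fin p))
    (S : Finset (Fin p)) : ℝ :=
  let v : ↥(support β \ S) → ℝ := fun j => β j.1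
  dotProduct v ((residualCov X (support β) S).mulVec v)

/-- The identifiability margin `τ`: the minimum of `β_Tᵀ D̂(S) β_T / |T|`, `T = S* \ S`, over all
`S` with `|S| = |S*|` making between `1` and `|S*|` mistakes. -/
def identifiabilityMargin {n p : ℕ} (X : Matrix (Fin n) (Fin p) ℝ)
    (β : EuclideanSpace ℝ (Fin p)) : ℝ :=
  sInf ((fun S : Finset (Fin p) => margin X β S / ((support β \ S).card : ℝ)) ''
    {S | S.card = (support β).card ∧
      ∃ t ∈ Finset.Icc 1 (support β).card, (S \ support β).card = t})

end

end PrivateBSS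

open PrivateBSS

/-!
Write `E` for the noise vector and, for a support `S ≠ S*` of size `s` with `k = |S \ S*|`
mistakes, let `V` be the span of the columns of the design in `S ∪ S*`, of dimension at most `2s`,
and `P_V` the orthogonal projection on it.

*Objective gap.* A residual vector at `S` has the form `E + u` with `u ∈ V`, and the Schur
complement formula gives `‖u‖² ≥ n * margin S ≥ n τ k` (`schur_le_sum_sq`). Since
`⟪E, u⟫ = ⟪P_V E, u⟫ ≥ -‖P_V E‖ ‖u‖`, as soon as `‖u‖ ≥ 4 ‖P_V E‖` the objective at `S` is at least
`‖E‖² + n τ k / 2` (`le_objective`). At the true support it is at most `‖E‖²`, because the true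
coefficients satisfy the norm constraint (`objective_support_le`). The constrained minimizers never
have to be computed.

*Noise.* A projection of the noise on a space of dimension `d` satisfies
`𝔼 exp (‖P_V E‖² / (4σ²)) ≤ 2 ^ (d / 2)`, by comparison with a Gaussian integral
(`lintegral_exp_norm_sq_le`). By Markov's inequality and a union bound over the at most `p ^ s`
supports, `‖P_V E‖² ≤ 16 σ² s log p` holds for all of them at once, except with probability
`p ^ s * 2 ^ s * p ^ (-4s) ≤ p⁻²` (`measureReal_largeNoise_le`). The universal constant `256` is
`4²` times this `16`.

*Mechanism.* Off the exceptional event `S*` is therefore the unique minimizer of the objective, so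
the classes are formed around it, and the objective grows by `n τ / 2 ≥ 8 (Δ / ε) log p` per
mistake. The weight of the `k`-th class is then at most `p ^ (-4k)` times that of `S*`, while the
class has at most `p ^ (2k)` members; summing the geometric series, `S*` is returned with
probability at least `1 / (1 + 2p⁻²)` (`le_mistakesProb_self`).
-/

open scoped RealInnerProductSpace

namespace PrivateBSS

/-! ### Exponential moments of squared norms -/

section GaussianMixture

variable {V : Type*} [NormedAddCommGroup V] [InnerProductSpace ℝ V] [FiniteDimensional ℝ V]
  [MeasurableSpace V] [BorelSpace V]

theorem lintegral_exp_neg_mul_sq_norm_add_inner {b : ℝ} (hb : 0 < b) (w : V) :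
    ∫⁻ v : V, ENNReal.ofReal (Real.exp (-b * ‖v‖ ^ 2 + ⟪w, v⟫)) =
      ENNReal.ofReal ((Real.pi / b) ^ (Module.finrank ℝ V / 2 : ℝ) *
        Real.exp (‖w‖ ^ 2 / (4 * b))) := by
  have hb' : 0 < (b : ℂ).re := by simpa using hb
  have hcast : ∀ v : V, Complex.exp (-(b : ℂ) * ‖v‖ ^ 2 + 1 * ⟪w, v⟫) =
      ((Real.exp (-b * ‖v‖ ^ 2 + ⟪w, v⟫) : ℝ) : ℂ) := fun v => by push_cast; simp
  have hint : Integrable fun v : V => Real.exp (-b * ‖v‖ ^ 2 + ⟪w, v⟫) := by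
    have h := GaussianFourier.integrable_cexp_neg_mul_sq_norm_add hb' 1 w
    simp_rw [hcast] at h
    exact h.re
  rw [← ofReal_integral_eq_lintegral_ofReal hint (ae_of_all _ fun v => (Real.exp_pos _).le)]
  congr 1
  have h := GaussianFourier.integral_cexp_neg_mul_sq_norm_add hb' 1 w
  simp_rw [hcast] at h
  rw [integral_complex_ofReal] at h
  apply Complex.ofReal_injective
  rw [h]
  push_cast
  rw [Complex.ofReal_cpow (by positivity)]
  push_cast
  simp

/-- Chi-square type bound: a `V`-valued random vector with sub-Gaussian marginals has a square
norm with the exponential moment of a Gaussian one. The reason is that `exp (‖w‖² / (4σ²))` is,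
up to a constant, the integral of `exp (-σ²‖v‖² + ⟪w, v⟫)` over `v`, so that by Tonelli only the
moment generating functions of the marginals enter. -/
theorem lintegral_exp_norm_sq_le {Ω : Type*} [MeasurableSpace Ω] {μ : Measure Ω}
    [SFinite μ] {W : Ω → V} (hW : Measurable W) {σ : ℝ} (hσ : 0 < σ)
    (hmgf : ∀ v : V, ∫⁻ ω, ENNReal.ofReal (Real.exp ⟪W ω, v⟫) ∂μ ≤
      ENNReal.ofReal (Real.exp (σ ^ 2 * ‖v‖ ^ 2 / 2))) :
    ∫⁻ ω, ENNReal.ofReal (Real.exp (‖W ω‖ ^ 2 / (4 * σ ^ 2))) ∂μ ≤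
      ENNReal.ofReal (2 ^ (Module.finrank ℝ V / 2 : ℝ)) := by
  have hb : 0 < σ ^ 2 := by positivity
  set d : ℝ := Module.finrank ℝ V / 2
  have hK : 0 < (Real.pi / σ ^ 2) ^ d := by positivity
  have hmeas : Measurable fun q : Ω × V =>
      ENNReal.ofReal (Real.exp (-σ ^ 2 * ‖q.2‖ ^ 2 + ⟪W q.1, q.2⟫)) := by fun_prop
  have key : ENNReal.ofReal ((Real.pi / σ ^ 2) ^ d) *
      ∫⁻ ω, ENNReal.ofReal (Real.exp (‖W ω‖ ^ 2 / (4 * σ ^ 2))) ∂μ ≤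
      ENNReal.ofReal ((Real.pi / σ ^ 2) ^ d) * ENNReal.ofReal (2 ^ d) := by
    calc _ = ∫⁻ ω, ∫⁻ v : V,
          ENNReal.ofReal (Real.exp (-σ ^ 2 * ‖v‖ ^ 2 + ⟪W ω, v⟫)) ∂volume ∂μ := by
          rw [← lintegral_const_mul _ (by fun_prop)]
          refine lintegral_congr fun ω => ?_
          rw [lintegral_exp_neg_mul_sq_norm_add_inner hb, ENNReal.ofReal_mul hK.le]
      _ = ∫⁻ v : V, ∫⁻ ω,
          ENNReal.ofReal (Real.exp (-σ ^ 2 * ‖v‖ ^ 2 + ⟪W ω, v⟫)) ∂μ ∂volume :=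
          lintegral_lintegral_swap hmeas.aemeasurable
      _ ≤ ∫⁻ v : V, ENNReal.ofReal (Real.exp (-(σ ^ 2 / 2) * ‖v‖ ^ 2 + ⟪(0 : V), v⟫)) := by
          refine lintegral_mono fun v => ?_
          simp_rw [Real.exp_add, ENNReal.ofReal_mul (Real.exp_pos _).le]
          rw [lintegral_const_mul _ (by fun_prop)]
          refine (mul_le_mul_right (hmgf v) _).trans (le_of_eq ?_)
          rw [← ENNReal.ofReal_mul (Real.exp_pos _).le, ← ENNReal.ofReal_mul (Real.exp_pos _).le,
            ← Real.exp_add, ← Real.exp_add]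
          congr 2
          rw [inner_zero_left]
          ring
      _ = ENNReal.ofReal ((Real.pi / σ ^ 2) ^ d) * ENNReal.ofReal (2 ^ d) := by
          rw [lintegral_exp_neg_mul_sq_norm_add_inner (by positivity), ← ENNReal.ofReal_mul hK.le,
            ← Real.mul_rpow (by positivity) (by positivity)]
          congr 1
          rw [norm_zero]
          simp only [ne_eq, OfNat.ofNat_ne_zero, not_false_eq_true, zero_pow, zero_div,
            Real.exp_zero, mul_one]
          congr 1
          field_simp
  exact (ENNReal.mul_le_mul_iff_right (by simpa using hK) ENNReal.ofReal_ne_top).1 key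

end GaussianMixture

/-! ### Projections of sub-Gaussian noise -/

section Noise

variable {n : ℕ} {Ω : Type*} [MeasurableSpace Ω] {μ : Measure Ω}
  {noise : Fin n → Ω → ℝ} {σ : ℝ}

/-- A linear functional of independent sub-Gaussian noise is sub-Gaussian, with parameter scaled by
the norm of the functional. -/
theorem lintegral_exp_inner_le (hindep : iIndepFun noise μ)
    (hsub : ∀ i, HasSubgaussianMGF (noise i) (Real.toNNReal (σ ^ 2)) μ)
    (v : EuclideanSpace ℝ (Fin n)) :
    ∫⁻ ω, ENNReal.ofReal (Real.exp ⟪WithLp.toLp 2 (fun i => noise i ω), v⟫) ∂μ ≤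
      ENNReal.ofReal (Real.exp (σ ^ 2 * ‖v‖ ^ 2 / 2)) := by
  have hind : iIndepFun (fun i ω => v i * noise i ω) μ :=
    hindep.comp (fun i x => v i * x) fun i => measurable_const_mul _
  have hscale : ∀ i, HasSubgaussianMGF (fun ω => v i * noise i ω)
      (Real.toNNReal (v i ^ 2 * σ ^ 2)) μ := fun i => by
    convert (hsub i).const_mul (v i) using 1
    rw [Real.toNNReal_mul (sq_nonneg _)]
    congr 1
    exact Real.toNNReal_of_nonneg _
  have h := HasSubgaussianMGF.sum_of_iIndepFun hind (s := Finset.univ) fun i _ => hscale i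
  have hin : ∀ ω, ⟪WithLp.toLp 2 (fun i => noise i ω), v⟫ = 1 * ∑ i, v i * noise i ω := fun ω => by
    simp [PiLp.inner_apply]
  simp_rw [hin]
  rw [← ofReal_integral_eq_lintegral_ofReal (h.integrable_exp_mul 1)
    (ae_of_all _ fun _ => (Real.exp_pos _).le)]
  refine ENNReal.ofReal_le_ofReal ((h.mgf_le 1).trans (le_of_eq ?_))
  congr 1
  rw [EuclideanSpace.norm_sq_eq]
  push_cast
  simp_rw [Real.coe_toNNReal _ (mul_nonneg (sq_nonneg (v _)) (sq_nonneg σ)), ← Finset.sum_mul,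
    Real.norm_eq_abs, sq_abs]
  ring

/-- The projection of the noise on a subspace of dimension at most `2s` exceeds the level
`16 σ² s L` with probability at most `2 ^ s * exp (-4 s L)`. -/
theorem measure_lt_norm_orthogonalProjection_le (hσ : 0 < σ) (hmeas : ∀ i, Measurable (noise i))
    (hindep : iIndepFun noise μ)
    (hsub : ∀ i, HasSubgaussianMGF (noise i) (Real.toNNReal (σ ^ 2)) μ)
    (V : Submodule ℝ (EuclideanSpace ℝ (Fin n))) {s : ℕ} (hV : Module.finrank ℝ V ≤ 2 * s)
    (L : ℝ) :
    μ {ω | 16 * σ ^ 2 * s * L <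
        ‖V.orthogonalProjectionOnto (WithLp.toLp 2 fun i => noise i ω)‖ ^ 2} ≤
      ENNReal.ofReal (2 ^ s * Real.exp (-(4 * s * L))) := by
  have := hindep.isProbabilityMeasure
  have hE : Measurable fun ω => (WithLp.toLp 2 fun i => noise i ω : EuclideanSpace ℝ (Fin n)) :=
    (WithLp.measurable_toLp 2 _).comp (measurable_pi_lambda _ hmeas)
  have hW : Measurable fun ω => V.orthogonalProjectionOnto (WithLp.toLp 2 fun i => noise i ω) :=
    V.orthogonalProjectionOnto.continuous.measurable.comp hE
  have hmom := lintegral_exp_norm_sq_le (μ := μ) hW hσ fun v => by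
    simpa using lintegral_exp_inner_le hindep hsub (v : EuclideanSpace ℝ (Fin n))
  have hpow : (2 : ℝ) ^ (Module.finrank ℝ V / 2 : ℝ) ≤ 2 ^ s := by
    rw [← Real.rpow_natCast]
    refine Real.rpow_le_rpow_of_exponent_le one_le_two ?_
    have : (Module.finrank ℝ V : ℝ) ≤ 2 * s := by exact_mod_cast hV
    linarith
  -- Markov's inequality for the exponential moment
  calc _ ≤ μ {ω | ENNReal.ofReal (Real.exp (4 * s * L)) ≤ ENNReal.ofReal (Real.exp
          (‖V.orthogonalProjectionOnto (WithLp.toLp 2 fun i => noise i ω)‖ ^ 2 / (4 * σ ^ 2)))} := by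
        refine measure_mono fun ω hω => ENNReal.ofReal_le_ofReal (Real.exp_le_exp.2 ?_)
        rw [le_div_iff₀ (by positivity)]
        have := Set.mem_ofPred_eq ▸ hω
        linarith
    _ ≤ _ := meas_ge_le_lintegral_div (by fun_prop)
        (by simpa using Real.exp_pos _) ENNReal.ofReal_ne_top
    _ ≤ ENNReal.ofReal (2 ^ s) / ENNReal.ofReal (Real.exp (4 * s * L)) := by
        gcongr
        exact hmom.trans (ENNReal.ofReal_le_ofReal hpow)
    _ = _ := by
        rw [← ENNReal.ofReal_div_of_pos (Real.exp_pos _), Real.exp_neg, div_eq_mul_inv]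

end Noise

/-! ### Sample covariance and Schur complement -/

section Covariance

variable {n p : ℕ} (X : Matrix (Fin n) (Fin p) ℝ)

theorem dotProduct_covBlock_mulVec (S T : Finset (Fin p)) (x : S → ℝ) (y : T → ℝ) :
    x ⬝ᵥ (covBlock X S T).mulVec y =
      (n : ℝ)⁻¹ * ∑ i, (∑ j : S, X i j * x j) * ∑ j : T, X i j * y j := by
  simp only [dotProduct, Matrix.mulVec, covBlock, Matrix.submatrix_apply, Matrix.smul_apply,
    Matrix.mul_apply, Matrix.transpose_apply, smul_eq_mul, Finset.mul_sum, Finset.sum_mul]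
  rw [Finset.sum_comm (s := (Finset.univ : Finset (Fin n)))]
  conv_rhs => enter [2, b]; rw [Finset.sum_comm]
  rw [Finset.sum_comm]
  refine Finset.sum_congr rfl fun b _ => Finset.sum_congr rfl fun a _ =>
    Finset.sum_congr rfl fun i _ => ?_
  ring

/-- The Schur complement bounds the residual of the best linear prediction from below: adding to
`X_T a` any combination of the columns in `S` leaves a squared length of at least
`n aᵀ (Σ_TT - Σ_TS Σ_SS⁻¹ Σ_ST) a`. -/
theorem schur_le_sum_sq {S : Finset (Fin p)} (hS : IsUnit (covBlock X S S)) (T : Finset (Fin p))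
    (a : T → ℝ) (c : S → ℝ) :
    n * (a ⬝ᵥ (covBlock X T T - covBlock X T S * (covBlock X S S)⁻¹ * covBlock X S T).mulVec a) ≤
      ∑ i, (∑ j : T, X i j * a j + ∑ j : S, X i j * c j) ^ 2 := by
  rcases Nat.eq_zero_or_pos n with rfl | hn
  · simp
  have hn' : (0 : ℝ) < n := by exact_mod_cast hn
  -- the coefficients of the least squares regression of `X_T a` on the columns in `S`
  set m : S → ℝ := (covBlock X S S)⁻¹.mulVec ((covBlock X S T).mulVec a)
  have hm : (covBlock X S S).mulVec m = (covBlock X S T).mulVec a := by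
    rw [Matrix.mulVec_mulVec, Matrix.mul_nonsing_inv _ ((Matrix.isUnit_iff_isUnit_det _).1 hS),
      Matrix.one_mulVec]
  -- the residual `X_T a - X_S m` is orthogonal to the columns in `S`
  have normal_eq : ∀ y : S → ℝ, ∑ i, (∑ j : S, X i j * y j) * ∑ j : T, X i j * a j =
      ∑ i, (∑ j : S, X i j * y j) * ∑ j : S, X i j * m j := fun y => by
    have h := congrArg (y ⬝ᵥ ·) hm
    simp only [dotProduct_covBlock_mulVec] at h
    exact (mul_left_cancel₀ (by positivity) h).symm
  rw [Matrix.sub_mulVec, dotProduct_sub, ← Matrix.mulVec_mulVec, ← Matrix.mulVec_mulVec,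
    dotProduct_covBlock_mulVec, dotProduct_covBlock_mulVec, mul_sub, mul_inv_cancel_left₀ hn'.ne',
    mul_inv_cancel_left₀ hn'.ne']
  have h1 := normal_eq m
  have h2 := normal_eq c
  have h3 : 0 ≤ ∑ i, (∑ j : S, X i j * m j + ∑ j : S, X i j * c j) ^ 2 :=
    Finset.sum_nonneg fun i _ => sq_nonneg _
  have h4 : ∑ i, (∑ j : T, X i j * a j) * ∑ j : S, X i j * m j =
      ∑ i, (∑ j : S, X i j * m j) * ∑ j : T, X i j * a j :=
    Finset.sum_congr rfl fun i _ => mul_comm _ _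
  have expand : ∀ u v : Fin n → ℝ, ∑ i, (u i + v i) ^ 2 =
      ∑ i, u i * u i + 2 * ∑ i, v i * u i + ∑ i, v i * v i := fun u v => by
    rw [Finset.mul_sum, ← Finset.sum_add_distrib, ← Finset.sum_add_distrib]
    exact Finset.sum_congr rfl fun i _ => by ring
  rw [expand] at h3 ⊢
  linarith

variable {X}

theorem SparseRiesz.isUnit_covBlock {s : ℕ} {κm κp : ℝ} (h : SparseRiesz X s κm κp) (hκ : 0 < κm)
    {S : Finset (Fin p)} (hS : S.card = s) : IsUnit (covBlock X S S) := by
  by_contra hu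
  exact absurd (h S hS 0 ((spectrum.zero_mem_iff ℝ).2 hu)).1 (not_le.2 hκ)

theorem isHermitian_covBlock (S : Finset (Fin p)) : (covBlock X S S).IsHermitian := by
  ext i j
  simp [covBlock, Matrix.mul_apply, mul_comm]

/-- Through this comparison the lower bound on the radius makes the true coefficients feasible. -/
theorem SparseRiesz.le {s : ℕ} {κm κp : ℝ} (h : SparseRiesz X s κm κp) {S : Finset (Fin p)}
    (hS : S.card = s) (hs : 1 ≤ s) : κm ≤ κp := by
  obtain ⟨j, hj⟩ : S.Nonempty := Finset.card_pos.1 (by omega)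
  have hl := h S hS ((isHermitian_covBlock S).eigenvalues ⟨j, hj⟩) (by
    rw [(isHermitian_covBlock S).spectrum_real_eq_range_eigenvalues]
    exact Set.mem_range_self _)
  exact hl.1.trans hl.2

end Covariance

/-! ### The least squares objective -/

section Objective

variable {n p : ℕ} {X : Matrix (Fin n) (Fin p) ℝ} {β : EuclideanSpace ℝ (Fin p)} {r : ℝ}

/-- The column space of the design restricted to the columns in `S`. -/
def columnSpan (X : Matrix (Fin n) (Fin p) ℝ) (S : Finset (Fin p)) :
    Submodule ℝ (EuclideanSpace ℝ (Fin n)) :=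
  Submodule.span ℝ (Set.range fun j : S => WithLp.toLp 2 fun i => X i j)

theorem finrank_columnSpan_le (S : Finset (Fin p)) :
    Module.finrank ℝ (columnSpan X S) ≤ S.card :=
  (finrank_range_le_card _).trans (by simp)

theorem sum_mem_columnSpan {S T : Finset (Fin p)} (hTS : T ⊆ S) (a : T → ℝ) :
    WithLp.toLp 2 (fun i => ∑ j : T, X i j * a j) ∈ columnSpan X S := by
  have : WithLp.toLp 2 (fun i => ∑ j : T, X i j * a j) =
      ∑ j : T, a j • (WithLp.toLp 2 fun i => X i j : EuclideanSpace ℝ (Fin n)) := by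
    ext i
    simp [mul_comm]
  rw [this]
  exact Submodule.sum_mem _ fun j _ => Submodule.smul_mem _ _
    (Submodule.subset_span ⟨⟨j, hTS j.2⟩, rfl⟩)

/-- The regression function splits into the true columns missing from `S` and the columns in `S`,
whose coefficients vanish outside of the true support. -/
theorem sum_eq_sum_sdiff_add_sum (S : Finset (Fin p)) (i : Fin n) :
    ∑ j, X i j * β j = ∑ j : ↥(support β \ S), X i j * β j + ∑ j : S, X i j * β j := by
  rw [Finset.sum_coe_sort (support β \ S) fun j => X i j * β j,
    Finset.sum_coe_sort S fun j => X i j * β j, ← Finset.sum_union Finset.sdiff_disjoint,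
    Finset.sdiff_union_self_eq_union]
  refine (Finset.sum_subset (Finset.subset_univ _) fun j _ hj => ?_).symm
  have : β j = 0 := by
    by_contra h
    exact hj (Finset.mem_union_left _ (by simp [support, h]))
  rw [this, mul_zero]

theorem bddBelow_objective_image (S : Finset (Fin p)) (D : Dataset n p) :
    BddBelow ((fun β : S → ℝ => ∑ i, ((D i).2 - ∑ j : S, (D i).1 j * β j) ^ 2) ''
      {β : S → ℝ | ∑ j, β j ^ 2 ≤ r ^ 2}) := by
  refine ⟨0, ?_⟩
  rintro _ ⟨b, -, rfl⟩
  exact Finset.sum_nonneg fun i _ => sq_nonneg _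

/-- The true coefficients are feasible, so the true support attains at most the noise energy. -/
theorem objective_support_le (hβ : ‖β‖ ≤ r) (e : Fin n → ℝ) :
    objective r (support β) (linearModel X β e) ≤ ∑ i, e i ^ 2 := by
  refine csInf_le (bddBelow_objective_image _ _) ⟨fun j => β j, ?_, ?_⟩
  · have h1 : ∑ j : support β, β j ^ 2 ≤ ∑ j, β j ^ 2 := by
      rw [Finset.sum_coe_sort (support β) fun j => β j ^ 2]
      exact Finset.sum_le_sum_of_subset_of_nonneg (Finset.subset_univ _)
        fun j _ _ => sq_nonneg _
    have h2 : ∑ j, β j ^ 2 = ‖β‖ ^ 2 := by simp [EuclideanSpace.norm_sq_eq]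
    exact (h1.trans h2.le).trans (pow_le_pow_left₀ (norm_nonneg _) hβ 2)
  · refine Finset.sum_congr rfl fun i _ => ?_
    simp only [linearModel]
    rw [sum_eq_sum_sdiff_add_sum (support β) i, Finset.sum_coe_sort (support β \ support β)
      fun j => X i j * β j, sdiff_self]
    simp

/-- If the projection of the noise on the columns in `S ∪ S*` is small compared to the
margin of `S`, then the objective at `S` exceeds the noise energy by half of `n` times that
margin. -/
theorem le_objective {S : Finset (Fin p)} (hS : IsUnit (covBlock X S S)) (e : Fin n → ℝ)
    (he : 16 * ‖(columnSpan X (S ∪ support β)).orthogonalProjectionOnto (WithLp.toLp 2 e)‖ ^ 2 ≤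
      n * margin X β S) :
    ∑ i, e i ^ 2 + n * margin X β S / 2 ≤ objective r S (linearModel X β e) := by
  refine le_csInf ((Set.nonempty_of_mem (x := 0) (by simp [sq_nonneg])).image _) ?_
  rintro _ ⟨b, -, rfl⟩
  set V := columnSpan X (S ∪ support β)
  set E : EuclideanSpace ℝ (Fin n) := WithLp.toLp 2 e
  set u : EuclideanSpace ℝ (Fin n) := WithLp.toLp 2 fun i =>
    ∑ j : ↥(support β \ S), X i j * β j + ∑ j : S, X i j * (β j - b j) with hu
  have huV : u ∈ V := V.add_mem
    (sum_mem_columnSpan (Finset.sdiff_subset.trans Finset.subset_union_right) fun j => β j)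
    (sum_mem_columnSpan Finset.subset_union_left fun j => β j - b j)
  have hnorm : ∑ i, ((linearModel X β e i).2 - ∑ j : S, (linearModel X β e i).1 j * b j) ^ 2 =
      ‖E + u‖ ^ 2 := by
    rw [EuclideanSpace.norm_sq_eq]
    refine Finset.sum_congr rfl fun i _ => ?_
    simp only [linearModel]
    rw [sum_eq_sum_sdiff_add_sum S i, Real.norm_eq_abs, sq_abs]
    simp only [E, u, PiLp.add_apply, mul_sub, Finset.sum_sub_distrib]
    ring
  have hmargin : n * margin X β S ≤ ‖u‖ ^ 2 := by
    refine (schur_le_sum_sq X hS (support β \ S) (fun j => β j) fun j => β j - b j).trans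
      (le_of_eq ?_)
    simp [EuclideanSpace.norm_sq_eq, hu]
  have hE : ∑ i, e i ^ 2 = ‖E‖ ^ 2 := by simp [EuclideanSpace.norm_sq_eq, E]
  have hinner : -(‖V.orthogonalProjectionOnto E‖ * ‖u‖) ≤ ⟪E, u⟫ := by
    have h1 : ⟪E, u⟫ = ⟪V.orthogonalProjectionOnto E, (⟨u, huV⟩ : V)⟫ := by
      simp
    have h2 := abs_real_inner_le_norm (V.orthogonalProjectionOnto E) (⟨u, huV⟩ : V)
    rw [h1]
    exact (abs_le.1 h2).1
  have hle : 4 * ‖V.orthogonalProjectionOnto E‖ ≤ ‖u‖ := by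
    refine le_of_sq_le_sq ?_ (norm_nonneg _)
    nlinarith
  refine le_of_le_of_eq ?_ hnorm.symm
  rw [hE, norm_add_sq_real]
  nlinarith [mul_le_mul_of_nonneg_right hle (norm_nonneg u)]

end Objective

/-! ### The mistakes method around the best support -/

section Mechanism

variable {n p s : ℕ}

/-- A support is determined by what it adds to and what it removes from `S₀`. -/
theorem card_mistakeClass_le (S₀ : Outcome p s) (k : ℕ) :
    (mistakeClass S₀ k).card ≤ (p ^ 2) ^ k := by
  have hinj : (mistakeClass S₀ k).card ≤
      (Finset.powersetCard k (Finset.univ : Finset (Fin p)) ×ˢ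
        Finset.powersetCard k (Finset.univ : Finset (Fin p))).card := by
    refine Finset.card_le_card_of_injOn (fun S => (S.1 \ S₀.1, S₀.1 \ S.1)) ?_ ?_
    · intro S hS
      have hk : (S.1 \ S₀.1).card = k := (Finset.mem_filter.1 hS).2
      have hk' : (S₀.1 \ S.1).card = k := by
        rw [← hk]
        exact Finset.card_sdiff_comm (S₀.2.trans S.2.symm)
      simp [Finset.mem_powersetCard, hk, hk']
    · intro S _ T _ h
      obtain ⟨h1, h2⟩ := Prod.ext_iff.1 h
      refine Subtype.ext (Finset.ext fun j => ?_)
      have h1 := Finset.ext_iff.1 h1 j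
      have h2 := Finset.ext_iff.1 h2 j
      simp only [Finset.mem_sdiff] at h1 h2
      tauto
  refine hinj.trans ?_
  rw [Finset.card_product, Finset.card_powersetCard, Finset.card_univ, Fintype.card_fin, sq, mul_pow]
  exact Nat.mul_le_mul (Nat.choose_le_pow p k) (Nat.choose_le_pow p k)

theorem mistakeClass_zero (S₀ : Outcome p s) : mistakeClass S₀ 0 = {S₀} := by
  ext S
  simp only [mistakeClass, Finset.mem_filter, Finset.mem_univ, true_and, Finset.card_eq_zero,
    Finset.sdiff_eq_empty_iff_subset, Finset.mem_singleton]
  constructor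
  · exact fun h => Subtype.ext (Finset.eq_of_subset_of_card_le h (S₀.2.trans S.2.symm).le)
  · rintro rfl
    exact subset_rfl

theorem classObjective_zero (r : ℝ) (S₀ : Outcome p s) (D : Dataset n p) :
    classObjective r S₀ 0 D = objective r S₀.1 D := by
  simp [classObjective, mistakeClass_zero]

theorem sum_range_pow_succ_le {x : ℝ} (h0 : 0 ≤ x) (h1 : x ≤ 1 / 2) (m : ℕ) :
    ∑ k ∈ Finset.range m, x ^ (k + 1) ≤ 2 * x := by
  -- the extra term makes the statement inductive
  suffices h : ∑ k ∈ Finset.range m, x ^ (k + 1) + 2 * x ^ (m + 1) ≤ 2 * x by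
    have : 0 ≤ x ^ (m + 1) := by positivity
    linarith
  induction m with
  | zero => simp
  | succ m ih =>
    have : x ^ (m + 2) ≤ x ^ (m + 1) * (1 / 2) := by
      rw [pow_succ x (m + 1)]
      gcongr
    rw [Finset.sum_range_succ]
    linarith

/-- If the objective grows by at least `g` per mistake and `ε g / (2Δ)` is at
least `4 log p`, the mistakes method built around `S₀` returns `S₀` with large probability. -/
theorem le_mistakesProb_self {ε Δ r g : ℝ} (hε : 0 < ε) (hΔ : 0 < Δ) (hp : 2 ≤ p)
    {S₀ : Outcome p s} {D : Dataset n p}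
    (hgap : ∀ S : Outcome p s, objective r S₀.1 D + g * (S.1 \ S₀.1).card ≤ objective r S.1 D)
    (hg : 4 * Real.log p ≤ ε * g / (2 * Δ)) :
    1 / (1 + 2 * (p : ℝ) ^ (-2 : ℤ)) ≤ mistakesProb ε Δ r S₀ D S₀ := by
  have hp0 : (0 : ℝ) < p := by exact_mod_cast (by omega : 0 < p)
  have hp2 : (2 : ℝ) ≤ p := by exact_mod_cast hp
  set w : ℕ → ℝ := fun k => classWeight ε Δ r S₀ k D
  have hw0 : 0 < w 0 := Real.exp_pos _
  set x : ℝ := (p : ℝ) ^ (-2 : ℤ) with hx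
  have hx' : x = ((p : ℝ) ^ 2)⁻¹ := by rw [hx, zpow_neg]; rfl
  have hx0 : 0 < x := by positivity
  have hxhalf : x ≤ 1 / 2 := by
    rw [hx', one_div]
    exact inv_anti₀ two_pos (by nlinarith)
  have hexp : Real.exp (-(4 * Real.log p)) = x ^ 2 := by
    rw [Real.exp_neg, hx', ← inv_pow, show (4 : ℝ) * Real.log p = (4 : ℕ) * Real.log p by norm_num,
      Real.exp_nat_mul, Real.exp_log hp0]
    rw [inv_pow, inv_pow, ← pow_mul]
  have hterm : ∀ k, ((mistakeClass S₀ k).card : ℝ) * w k ≤ w 0 * x ^ k := by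
    intro k
    -- on an empty class `classObjective` is the junk value `sInf ∅`, but its weight is not counted
    rcases (mistakeClass S₀ k).eq_empty_or_nonempty with h | h
    · rw [h]
      simp only [Finset.card_empty, Nat.cast_zero, zero_mul]
      positivity
    have hobj : classObjective r S₀ 0 D + g * k ≤ classObjective r S₀ k D := by
      rw [classObjective_zero]
      refine le_csInf (h.to_set.image _) ?_
      rintro _ ⟨S, hS, rfl⟩
      have hk : (S.1 \ S₀.1).card = k := (Finset.mem_filter.1 hS).2
      simpa [hk] using hgap S
    have hwk : w k ≤ w 0 * (x ^ 2) ^ k := by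
      rw [← hexp, ← Real.exp_nat_mul]
      simp only [w, classWeight]
      rw [← Real.exp_add, Real.exp_le_exp]
      have h1 : ε * (classObjective r S₀ 0 D + g * k) / (2 * Δ) ≤
          ε * classObjective r S₀ k D / (2 * Δ) := by gcongr
      have h2 := mul_le_mul_of_nonneg_left hg (Nat.cast_nonneg (α := ℝ) k)
      have h3 : ε * (classObjective r S₀ 0 D + g * k) / (2 * Δ) =
          ε * classObjective r S₀ 0 D / (2 * Δ) + k * (ε * g / (2 * Δ)) := by ring
      rw [neg_mul, neg_mul, neg_div, neg_div]
      linarith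
    have hcard : ((mistakeClass S₀ k).card : ℝ) ≤ (x⁻¹) ^ k := by
      rw [hx', inv_inv]
      exact_mod_cast card_mistakeClass_le S₀ k
    have hwk0 : 0 ≤ w k := (Real.exp_pos _).le
    calc _ ≤ (x⁻¹) ^ k * (w 0 * (x ^ 2) ^ k) := by gcongr
      _ = w 0 * x ^ k * (x⁻¹ * x) ^ k := by ring
      _ = w 0 * x ^ k := by rw [inv_mul_cancel₀ hx0.ne', one_pow, mul_one]
  have hsum : ∑ i ∈ Finset.range (s + 1), ((mistakeClass S₀ i).card : ℝ) * w i ≤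
      w 0 * (1 + 2 * x) := by
    refine (Finset.sum_le_sum fun k _ => hterm k).trans ?_
    rw [← Finset.mul_sum, Finset.sum_range_succ']
    have := sum_range_pow_succ_le hx0.le hxhalf s
    refine mul_le_mul_of_nonneg_left ?_ hw0.le
    rw [pow_zero]
    linarith
  have hpos : 0 < ∑ i ∈ Finset.range (s + 1), ((mistakeClass S₀ i).card : ℝ) * w i := by
    rw [← sum_classWeight]
    exact Finset.sum_pos (fun S _ => Real.exp_pos _) ⟨S₀, Finset.mem_univ _⟩
  have hself : mistakesProb ε Δ r S₀ D S₀ =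
      w 0 / ∑ i ∈ Finset.range (s + 1), ((mistakeClass S₀ i).card : ℝ) * w i := by
    simp [mistakesProb, w]
  rw [hself, div_le_div_iff₀ (by positivity) hpos, one_mul]
  exact hsum

end Mechanism

/-! ### Recovery of the true support -/

section Recovery

variable {n p s : ℕ} {X : Matrix (Fin n) (Fin p) ℝ} {β : EuclideanSpace ℝ (Fin p)}

/-- The event that, for some support `S`, the projection of the noise on the columns in
`S ∪ S*` has squared length above `16 σ² s log p`. -/
def largeNoise {Ω : Type*} (X : Matrix (Fin n) (Fin p) ℝ) (β : EuclideanSpace ℝ (Fin p)) (s : ℕ)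
    (σ : ℝ) (noise : Fin n → Ω → ℝ) : Set Ω :=
  ⋃ S : Outcome p s, {ω | 16 * σ ^ 2 * s * Real.log p <
    ‖(columnSpan X (S.1 ∪ support β)).orthogonalProjectionOnto
      (WithLp.toLp 2 fun i => noise i ω)‖ ^ 2}

theorem measurableSet_largeNoise {Ω : Type*} [MeasurableSpace Ω] {noise : Fin n → Ω → ℝ}
    (hmeas : ∀ i, Measurable (noise i)) (σ : ℝ) : MeasurableSet (largeNoise X β s σ noise) := by
  have hE : Measurable fun ω => (WithLp.toLp 2 fun i => noise i ω : EuclideanSpace ℝ (Fin n)) :=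
    (WithLp.measurable_toLp 2 _).comp (measurable_pi_lambda _ hmeas)
  refine MeasurableSet.iUnion fun S => measurableSet_lt measurable_const ?_
  have := (columnSpan X (S.1 ∪ support β)).orthogonalProjectionOnto.continuous.measurable.comp hE
  exact (this.norm).pow_const 2

theorem measureReal_largeNoise_le {Ω : Type*} [MeasurableSpace Ω] {μ : Measure Ω}
    {noise : Fin n → Ω → ℝ} {σ : ℝ} (hσ : 0 < σ) (hmeas : ∀ i, Measurable (noise i))
    (hindep : iIndepFun noise μ)
    (hsub : ∀ i, HasSubgaussianMGF (noise i) (Real.toNNReal (σ ^ 2)) μ)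
    (hβ : (support β).card = s) (hs : 1 ≤ s) (hp : 2 ≤ p) :
    μ.real (largeNoise X β s σ noise) ≤ (p : ℝ) ^ (-2 : ℤ) := by
  have hp1 : (1 : ℝ) ≤ p := by exact_mod_cast (by omega : 1 ≤ p)
  have hp2 : (2 : ℝ) ≤ p := by exact_mod_cast hp
  have hp0 : (0 : ℝ) < p := by linarith
  refine ENNReal.toReal_le_of_le_ofReal (by positivity) ?_
  refine (measure_iUnion_fintype_le μ _).trans ((Finset.sum_le_sum fun S _ =>
    measure_lt_norm_orthogonalProjection_le hσ hmeas hindep hsub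
      (columnSpan X (S.1 ∪ support β)) (s := s) ?_ (Real.log p)).trans ?_)
  · refine (finrank_columnSpan_le _).trans ((Finset.card_union_le _ _).trans ?_)
    rw [S.2, hβ, two_mul]
  rw [Finset.sum_const, nsmul_eq_mul, Finset.card_univ, Fintype.card_finset_len, Fintype.card_fin,
    ← ENNReal.ofReal_natCast, ← ENNReal.ofReal_mul (by positivity)]
  refine ENNReal.ofReal_le_ofReal ?_
  have hchoose : (p.choose s : ℝ) ≤ (p : ℝ) ^ s := by exact_mod_cast Nat.choose_le_pow p s
  have hexp : Real.exp (-(4 * s * Real.log p)) = (((p : ℝ) ^ s) ^ 4)⁻¹ := by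
    rw [Real.exp_neg, ← pow_mul, mul_comm s 4, ← Real.exp_log (pow_pos hp0 (4 * s)), Real.log_pow]
    push_cast
    rfl
  have hps : (p : ℝ) ≤ (p : ℝ) ^ s := le_self_pow₀ hp1 (by omega)
  calc _ ≤ (p : ℝ) ^ s * ((p : ℝ) ^ s * (((p : ℝ) ^ s) ^ 4)⁻¹) := by
        rw [hexp]
        gcongr
    _ = (((p : ℝ) ^ s) ^ 2)⁻¹ := by
        field_simp
    _ ≤ ((p : ℝ) ^ 2)⁻¹ := by gcongr
    _ = (p : ℝ) ^ (-2 : ℤ) := by rw [zpow_neg]; rfl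

/-- As `S` and `S*` have the same size, `|S* \ S| = |S \ S*|`. -/
theorem identifiabilityMargin_mul_le (hβ : (support β).card = s) {S : Finset (Fin p)}
    (hS : S.card = s) (hne : S ≠ support β) :
    identifiabilityMargin X β * ((S \ support β).card : ℝ) ≤ margin X β S ∧
      1 ≤ (S \ support β).card := by
  have hcard : (support β \ S).card = (S \ support β).card :=
    Finset.card_sdiff_comm (hβ.trans hS.symm)
  have hpos : 1 ≤ (S \ support β).card := by
    rw [Nat.one_le_iff_ne_zero, Ne, Finset.card_eq_zero, Finset.sdiff_eq_empty_iff_subset]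
    exact fun h => hne (Finset.eq_of_subset_of_card_le h (hβ.trans hS.symm).le)
  refine ⟨?_, hpos⟩
  rw [← hcard, ← le_div_iff₀ (by rw [hcard]; exact_mod_cast hpos)]
  refine csInf_le ((Set.toFinite _).image _).bddBelow ⟨S, ⟨hS.trans hβ.symm, _,
    Finset.mem_Icc.2 ⟨hpos, ?_⟩, rfl⟩, rfl⟩
  rw [hβ, ← hS]
  exact Finset.card_le_card Finset.sdiff_subset

/-- Off the event `largeNoise` the true support is the unique minimizer of the objective, so the
mistake classes are formed around it, and the method returns it with large probability. -/
theorem le_mistakesProb_support {σ κm κp r ε Δ : ℝ} {best : Dataset n p → Outcome p s}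
    (hβ : (support β).card = s) (hσ : 0 < σ) (hs : 1 ≤ s) (hp : 2 ≤ p) (hn : 0 < n)
    (hκ : 0 < κm) (hX : SparseRiesz X s κm κp) (hr : ‖β‖ ≤ r) (hε : 0 < ε) (hΔ : 0 < Δ)
    (hτ : max (256 * σ ^ 2 * s) (16 * Δ / ε) * (Real.log p / n) ≤ identifiabilityMargin X β)
    (hbest : IsBestSupport r best) {Ω : Type*} {noise : Fin n → Ω → ℝ} {ω : Ω}
    (hω : ω ∉ largeNoise X β s σ noise) :
    1 / (1 + 2 * (p : ℝ) ^ (-2 : ℤ)) ≤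
      mistakesProb ε Δ r (best (linearModel X β fun k => noise k ω))
        (linearModel X β fun k => noise k ω) ⟨support β, hβ⟩ := by
  set D := linearModel X β fun k => noise k ω
  set τ := identifiabilityMargin X β
  have hn' : (0 : ℝ) < n := by exact_mod_cast hn
  have hs' : (1 : ℝ) ≤ s := by exact_mod_cast hs
  have hlog : 0 < Real.log p := Real.log_pos (by exact_mod_cast hp)
  have hnτ : max (256 * σ ^ 2 * s) (16 * Δ / ε) * Real.log p ≤ n * τ := by
    rw [← mul_div_assoc, div_le_iff₀ hn'] at hτ
    linarith
  have hτ1 : 256 * σ ^ 2 * s * Real.log p ≤ n * τ :=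
    (mul_le_mul_of_nonneg_right (le_max_left _ _) hlog.le).trans hnτ
  have hτ2 : 16 * Δ / ε * Real.log p ≤ n * τ :=
    (mul_le_mul_of_nonneg_right (le_max_right _ _) hlog.le).trans hnτ
  have hτ0 : 0 < n * τ := lt_of_lt_of_le (by positivity) hτ1
  have hlower : ∀ S : Outcome p s, S.1 ≠ support β →
      ∑ i, noise i ω ^ 2 + n * τ / 2 * (S.1 \ support β).card ≤ objective r S.1 D := by
    intro S hne
    obtain ⟨hm, hk⟩ := identifiabilityMargin_mul_le (X := X) hβ S.2 hne
    have hk' : (1 : ℝ) ≤ ((S.1 \ support β).card : ℝ) := by exact_mod_cast hk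
    have hm' := mul_le_mul_of_nonneg_left hm hn'.le
    have hnoise : ‖(columnSpan X (S.1 ∪ support β)).orthogonalProjectionOnto
        (WithLp.toLp 2 fun i => noise i ω)‖ ^ 2 ≤ 16 * σ ^ 2 * s * Real.log p :=
      not_lt.1 fun h => hω (Set.mem_iUnion.2 ⟨S, h⟩)
    have hk2 : n * τ ≤ n * τ * ((S.1 \ support β).card : ℝ) := le_mul_of_one_le_right hτ0.le hk'
    refine le_trans ?_ (le_objective (hX.isUnit_covBlock hκ S.2) (fun i => noise i ω) ?_)
    · linarith
    · linarith
  have hupper := objective_support_le (X := X) hr fun i => noise i ω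
  have hbest_eq : best D = ⟨support β, hβ⟩ := by
    by_contra h
    have hne : (best D).1 ≠ support β := fun h' => h (Subtype.ext h')
    have h1 := hlower _ hne
    have h2 : objective r (best D).1 D ≤ objective r (support β) D := hbest D ⟨support β, hβ⟩
    have hk : (1 : ℝ) ≤ (((best D).1 \ support β).card : ℝ) := by
      exact_mod_cast (identifiabilityMargin_mul_le (X := X) hβ (best D).2 hne).2
    have : 0 < n * τ / 2 * (((best D).1 \ support β).card : ℝ) := by positivity
    linarith
  rw [hbest_eq]
  refine le_mistakesProb_self (g := n * τ / 2) hε hΔ hp (fun S => ?_) ?_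
  · by_cases hS : S.1 = support β
    · simp [hS]
    · have := hlower S hS
      dsimp only at this ⊢
      linarith
  · rw [div_mul_eq_mul_div, div_le_iff₀ hε] at hτ2
    rw [le_div_iff₀ (by positivity)]
    linarith

end Recovery

/-! ### From conditional to overall probability -/

/-- If outside of the event `N` the algorithm returns `o` with conditional probability at least
`q`, then it returns `o` with probability at least `q (1 - μ N)`. -/
theorem IsOutputOf.mul_le_measureReal {Ω 𝒟 O : Type*} [MeasurableSpace Ω] [MeasurableSpace 𝒟]
    {μ : Measure Ω} [IsProbabilityMeasure μ] {A : 𝒟 → PMF O} {D : Ω → 𝒟} {out : Ω → O}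
    (h : IsOutputOf μ A D out) {o : O} {N : Set Ω} (hN : MeasurableSet N) {q : ℝ} (hq : 0 ≤ q)
    (hqA : ∀ ω ∉ N, ENNReal.ofReal q ≤ A (D ω) o) :
    q * (1 - μ.real N) ≤ μ.real {ω | out ω = o} := by
  have hout : μ {ω | out ω = o} = ∫⁻ ω, A (D ω) o ∂μ := by
    simpa using (h o).2 Set.univ MeasurableSet.univ
  have hle : ENNReal.ofReal q * μ Nᶜ ≤ μ {ω | out ω = o} := by
    rw [hout, ← setLIntegral_const]
    exact (setLIntegral_mono' hN.compl hqA).trans (setLIntegral_le_lintegral _ _)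
  have := ENNReal.toReal_mono (measure_ne_top μ _) hle
  rw [ENNReal.toReal_mul, ENNReal.toReal_ofReal hq] at this
  rw [← probReal_compl_eq_one_sub hN]
  exact this

end PrivateBSS

open PrivateBSS
theorem theorem4 :
    ∃ C : ℝ, 0 < C ∧
      ∀ (n p s : ℕ) (X : Matrix (Fin n) (Fin p) ℝ) (βstar : EuclideanSpace ℝ (Fin p))
        (Ω : Type*) [MeasurableSpace Ω] (μ : Measure Ω) [IsProbabilityMeasure μ]
        (noise : Fin n → Ω → ℝ) (σ bx byy M κm κp r ε Δ : ℝ)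
        (best : Dataset n p → Outcome p s) (out : Ω → Outcome p s),
        -- the true support has `s` elements, with `1 ≤ s < p`
        (support βstar).card = s → 1 ≤ s → s < p →
        -- i.i.d. zero-mean sub-Gaussian noise with parameter `σ`
        0 < σ → (∀ i, Measurable (noise i)) → iIndepFun noise μ →
        (∀ i j, IdentDistrib (noise i) (noise j) μ μ) →
        (∀ i, ∫ ω, noise i ω ∂μ = 0) →
        (∀ i, HasSubgaussianMGF (noise i) (Real.toNNReal (σ ^ 2)) μ) →
        -- bounded data
        0 < bx → 0 < byy → (∀ i j, |X i j| ≤ bx) →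
        (∀ᵐ ω ∂μ, ∀ i, |(linearModel X βstar (fun k => noise k ω) i).2| ≤ byy) →
        -- bounded coefficients
        0 < M → ‖βstar‖ ≤ M →
        -- sparse Riesz condition
        0 < κm → 0 < κp → SparseRiesz X s κm κp →
        -- sparsity
        (s : ℝ) ≤ n / Real.log p → 3 ≤ p →
        -- choice of the radius, of the sensitivity bound and of the privacy parameter
        κp / κm * M + 4 * (σ * bx / κm) ≤ r →
        Δ = 2 * byy ^ 2 + 2 * bx ^ 2 * r ^ 2 * s →
        0 < ε →
        -- lower bound on the identifiability margin
        max (C * σ ^ 2 * s) (16 * Δ / ε) * (Real.log p / n) ≤ identifiabilityMargin X βstar →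
        -- `out` is the output of the mistakes method on the data
        IsBestSupport r best →
        IsOutputOf μ (mistakesMethod ε Δ r best)
          (fun ω => linearModel X βstar (fun k => noise k ω)) out →
        (1 - 18 * s * (p : ℝ) ^ (-2 : ℤ)) / (1 + 2 * (p : ℝ) ^ (-2 : ℤ)) ≤
          μ.real {ω | (out ω).1 = support βstar} := by
  refine ⟨256, by norm_num, ?_⟩
  intro n p s X βstar Ω _ μ _ noise σ bx byy M κm κp r ε Δ best out hcard hs hsp hσ hmeas hindep
    _ _ hsub hbx hbyy _ _ hM hβM hκm hκp hX hsn hp hr hΔ hε hτ hbest hout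
  have hlog : 0 < Real.log p := Real.log_pos (by exact_mod_cast (by omega : 1 < p))
  have hs' : (1 : ℝ) ≤ s := by exact_mod_cast hs
  have hn : 0 < n := by
    rcases Nat.eq_zero_or_pos n with rfl | h
    · rw [Nat.cast_zero, zero_div] at hsn
      linarith
    · exact h
  have hβr : ‖βstar‖ ≤ r := by
    have h1 : M ≤ κp / κm * M :=
      le_mul_of_one_le_left hM.le ((one_le_div hκm).2 (hX.le hcard hs))
    have h2 : 0 ≤ 4 * (σ * bx / κm) := by positivity
    linarith
  have hΔ0 : 0 < Δ := by
    rw [hΔ]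
    positivity
  set x : ℝ := (p : ℝ) ^ (-2 : ℤ)
  have hx : 0 ≤ x := by positivity
  have hprob := hout.mul_le_measureReal (o := ⟨support βstar, hcard⟩) (q := 1 / (1 + 2 * x))
    (measurableSet_largeNoise (X := X) (β := βstar) (s := s) hmeas σ) (by positivity)
    fun ω hω => ENNReal.ofReal_le_ofReal
      (le_mistakesProb_support hcard hσ hs (by omega) hn hκm hX hβr hε hΔ0 hτ hbest hω)
  have hnoise := measureReal_largeNoise_le (X := X) hσ hmeas hindep hsub hcard hs (by omega)
  have hset : {ω | (out ω).1 = support βstar} = {ω | out ω = ⟨support βstar, hcard⟩} := by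
    ext ω
    simp [Subtype.ext_iff]
  rw [hset]
  refine le_trans ?_ hprob
  rw [one_div_mul_eq_div]
  have hsx : x ≤ s * x := le_mul_of_one_le_left hx hs'
  gcongr
  linarith
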